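/- **Theorem (the strong Banach–Tarski paradox).** Let $G_3$ be the group of all transformations $x \mapsto Rx + b$ of $\mathbb{R}^3$, where $R \in SO(3)$ (a real orthogonal $3\times 3$ matrix of determinant $1$) and $b \in \mathbb{R}^3$. Let $A$ and $B$ be bounded subsets of $\mathbb{R}^3$ with nonempty interiors. Then $A$ and $B$ are $G_3$-equidecomposable: there are a natural number $n$, partitions $A = A_1 \cup \dots \cup A_n$ and $B = B_1 \cup \dots \cup B_n$ into nonempty, pairwise disjoint subsets, and elements $g_1, \dots, g_n \in G_3$ such that $B_i = g_i A_i$ for all $i = 1, \dots, n$. -/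

import Mathlib

open scoped Pointwise

namespace BanachTarski

/-- Euclidean three-space. -/
abbrev R3 : Type := EuclideanSpace ℝ (Fin 3)

/-- The group `G₃` of all transformations `x ↦ A x + b` of `ℝ³` with `A ∈ SO(3)` and `b ∈ ℝ³`,
as a subgroup of the group of all bijections of `ℝ³`; it acts on `ℝ³` by evaluation. -/
def G3 : Subgroup (Equiv.Perm R3) where
  carrier := {g | ∃ A ∈ Matrix.specialOrthogonalGroup (Fin 3) ℝ, ∃ b : R3,
    ∀ x : R3, g x = Matrix.toEuclideanLin A x + b}
  one_mem' := ⟨1, one_mem _, 0, fun x => by simp [Matrix.toLpLin_one]⟩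
  mul_mem' := by
    rintro g h ⟨A, hA, b, hg⟩ ⟨B, hB, c, hh⟩
    refine ⟨A * B, mul_mem hA hB, Matrix.toEuclideanLin A c + b, fun x => ?_⟩
    rw [Equiv.Perm.mul_apply, hg, hh, map_add, add_assoc]
    simp [Matrix.toLpLin_apply, Matrix.mulVec_mulVec]
  inv_mem' := by
    rintro g ⟨A, hA, b, hg⟩
    obtain ⟨hO, hdet⟩ := Matrix.mem_specialOrthogonalGroup_iff.1 hA
    have hs : A.transpose * A = 1 := (Matrix.mem_orthogonalGroup_iff' _ _).1 hO
    have hA' : A.transpose ∈ Matrix.specialOrthogonalGroup (Fin 3) ℝ := by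
      refine Matrix.mem_specialOrthogonalGroup_iff.2
        ⟨(Matrix.mem_orthogonalGroup_iff _ _).2 ?_, by rw [Matrix.det_transpose, hdet]⟩
      simpa using hs
    refine ⟨A.transpose, hA', -Matrix.toEuclideanLin A.transpose b, fun x => ?_⟩
    obtain ⟨y, rfl⟩ := g.surjective x
    have hy : g⁻¹ (g y) = y := g.symm_apply_apply y
    rw [hy, hg, map_add, add_neg_cancel_right]
    simp [Matrix.toLpLin_apply, Matrix.mulVec_mulVec, hs]

/-- `P 0, …, P (n - 1)` is a decomposition (partition) of the set `A`: the pieces are nonempty and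
pairwise disjoint, and their union is `A`. -/
def IsDecomposition {X : Type*} (A : Set X) {n : ℕ} (P : Fin n → Set X) : Prop :=
  (∀ i, (P i).Nonempty) ∧ (∀ i j, i ≠ j → Disjoint (P i) (P j)) ∧ A = ⋃ i, P i

/-- `A` and `B` are `G`-equidecomposable: they have decompositions into the same finite number of
pieces `P i`, `Q i` with `Q i = g i • P i` for some elements `g i` of `G`. -/
def Equidecomposable (G : Type*) {X : Type*} [Group G] [MulAction G X] (A B : Set X) : Prop :=
  ∃ (n : ℕ) (P Q : Fin n → Set X) (g : Fin n → G),
    IsDecomposition A P ∧ IsDecomposition B Q ∧ ∀ i, Q i = g i • P i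

end BanachTarski

/-! By Banach–Schröder–Bernstein (`PiecewiseEmbeds.equidecomposable`) it is enough to embed any
bounded set piecewise into any set with interior, hence into a small ball.

Two rotations generate a free group of rank two in SO(3) (`freeRotation_injective`). On the points
of a ball with trivial stabilizer this group acts freely, so its own paradoxical decomposition
transfers to them along orbits (`isParadoxical_of_free`). A paradoxical set contains arbitrarily
many disjoint piecewise copies of itself, so it absorbs any set covered by finitely many of its
translates (`IsParadoxical.piecewiseEmbeds`).

The points fixed by a nontrivial rotation lie on countably many lines through the origin. A short
translation moves all of them off these lines (`exists_short_translation`), so using each translate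
of the free part twice, the second time slightly shifted, covers a bounded set without gaps. -/

namespace BanachTarski

/-! ### Piecewise maps, Schröder–Bernstein and paradoxical sets -/

section Piecewise

variable {G X : Type*} [Group G] [MulAction G X]

/-- On the set `A`, the map `f` is given by finitely many elements of `G`. -/
def IsPiecewise (G : Type*) {X : Type*} [Group G] [MulAction G X] (A : Set X) (f : X → X) : Prop :=
  ∃ S : Set G, S.Finite ∧ ∀ x ∈ A, ∃ g ∈ S, f x = g • x

theorem IsPiecewise.comp {A B : Set X} {f h : X → X} (hh : IsPiecewise G B h)
    (hf : IsPiecewise G A f) (hm : Set.MapsTo f A B) : IsPiecewise G A (h ∘ f) := by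
  obtain ⟨S, hS, hS'⟩ := hf
  obtain ⟨T, hT, hT'⟩ := hh
  refine ⟨T * S, hT.mul hS, fun x hx => ?_⟩
  obtain ⟨g, hg, hgx⟩ := hS' x hx
  obtain ⟨k, hk, hkx⟩ := hT' (f x) (hm hx)
  exact ⟨k * g, Set.mul_mem_mul hk hg, by rw [Function.comp_apply, hkx, hgx, mul_smul]⟩

theorem isPiecewise_smul (A : Set X) (g : G) : IsPiecewise G A (fun x => g • x) :=
  ⟨{g}, Set.finite_singleton g, fun _ _ => ⟨g, rfl, rfl⟩⟩

theorem IsPiecewise.iterate {A : Set X} {f : X → X} (hf : IsPiecewise G A f)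
    (hm : Set.MapsTo f A A) (n : ℕ) : IsPiecewise G A f^[n] := by
  induction n with
  | zero => exact ⟨{1}, Set.finite_singleton 1, fun x _ => ⟨1, rfl, (one_smul G x).symm⟩⟩
  | succ n ih => rw [Function.iterate_succ']; exact hf.comp ih (hm.iterate n)

/-- `A` embeds piecewise into `B`. -/
def PiecewiseEmbeds (G : Type*) {X : Type*} [Group G] [MulAction G X] (A B : Set X) : Prop :=
  ∃ f : X → X, IsPiecewise G A f ∧ Set.MapsTo f A B ∧ Set.InjOn f A

theorem PiecewiseEmbeds.trans {A B C : Set X} (h₁ : PiecewiseEmbeds G A B)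
    (h₂ : PiecewiseEmbeds G B C) : PiecewiseEmbeds G A C := by
  obtain ⟨f, hf, hfm, hfi⟩ := h₁
  obtain ⟨h, hh, hhm, hhi⟩ := h₂
  exact ⟨h ∘ f, hh.comp hf hfm, hhm.comp hfm, hhi.comp hfi hfm⟩

theorem PiecewiseEmbeds.of_smul_subset {A B : Set X} (g : G) (h : g • A ⊆ B) :
    PiecewiseEmbeds G A B :=
  ⟨fun x => g • x, isPiecewise_smul A g, fun _ hx => h (Set.smul_mem_smul_set hx),
    (MulAction.injective g).injOn⟩

/-- The Banach–Schröder–Bernstein theorem. -/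
theorem PiecewiseEmbeds.equidecomposable {A B : Set X} (h₁ : PiecewiseEmbeds G A B)
    (h₂ : PiecewiseEmbeds G B A) : Equidecomposable G A B := by
  classical
  obtain ⟨f, ⟨S, hS, hSf⟩, hfm, hfi⟩ := h₁
  obtain ⟨h, ⟨T, hT, hTh⟩, hhm, hhi⟩ := h₂
  -- The bijection follows `f` at some points and the inverse of `h` at the others, so the elements
  -- of `S ∪ T⁻¹` suffice for it.
  obtain ⟨k, hk, hkR⟩ := Function.Embedding.schroeder_bernstein_of_rel
    (hfm.restrict_inj.2 hfi) (hhm.restrict_inj.2 hhi)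
    (fun x y => ∃ g ∈ S ∪ T⁻¹, (y : X) = g • (x : X))
    (fun a => by
      obtain ⟨g, hg, hga⟩ := hSf a a.2
      exact ⟨g, Or.inl hg, hga⟩)
    (fun b => by
      obtain ⟨g, hg, hgb⟩ := hTh b b.2
      exact ⟨g⁻¹, Or.inr (by simpa using hg), by
        rw [Set.MapsTo.val_restrict_apply, hgb, inv_smul_smul]⟩)
  choose c hcS hc using hkR
  have hfin : (Set.range c).Finite := (hS.union hT.inv).subset (by rintro _ ⟨a, rfl⟩; exact hcS a)
  -- The pieces are the fibres of `c`. Indexing them by the range of `c`, and not by `S ∪ T⁻¹`,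
  -- keeps every piece nonempty.
  obtain ⟨n, e, hei, her⟩ : ∃ (n : ℕ) (e : Fin n → G), Function.Injective e ∧
      Set.range e = Set.range c := by
    have := hfin.fintype
    let e := (Fintype.equivFin (Set.range c)).symm
    exact ⟨_, fun i => e i, Subtype.val_injective.comp e.injective, by
      
      change Set.range (Subtype.val ∘ e) = _
      rw [e.surjective.range_comp, Subtype.range_coe]⟩
  let P : Fin n → Set X := fun i => Subtype.val '' {a : A | c a = e i}
  have hPne : ∀ i, (P i).Nonempty := fun i => by
    obtain ⟨a, ha⟩ : e i ∈ Set.range c := her ▸ Set.mem_range_self i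
    exact ⟨a, a, ha, rfl⟩
  refine ⟨n, P, fun i => e i • P i, e, ⟨hPne, ?_, ?_⟩, ⟨fun i => (hPne i).smul_set, ?_, ?_⟩,
    fun i => rfl⟩
  · refine fun i j hij => Set.disjoint_left.2 ?_
    rintro _ ⟨a, ha, rfl⟩ ⟨b, hb, hab⟩
    obtain rfl := Subtype.ext hab
    exact hij (hei (ha.symm.trans hb))
  · ext x
    simp only [Set.mem_iUnion]
    constructor
    · intro hx
      obtain ⟨i, hi⟩ : c ⟨x, hx⟩ ∈ Set.range e := her ▸ Set.mem_range_self _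
      exact ⟨i, ⟨x, hx⟩, hi.symm, rfl⟩
    · rintro ⟨i, a, -, rfl⟩
      exact a.2
  · refine fun i j hij => Set.disjoint_left.2 ?_
    rintro _ ⟨_, ⟨a, ha, rfl⟩, rfl⟩ ⟨_, ⟨b, hb, rfl⟩, hab⟩
    simp only [Set.mem_ofPred_eq] at ha hb
    have hab' : k b = k a := Subtype.ext (by rw [hc, hc, ha, hb]; exact hab)
    obtain rfl := hk.1 hab'
    exact hij (hei (ha.symm.trans hb))
  · ext y
    simp only [Set.mem_iUnion]
    constructor
    · intro hy
      obtain ⟨a, ha⟩ := hk.2 ⟨y, hy⟩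
      obtain ⟨i, hi⟩ : c a ∈ Set.range e := her ▸ Set.mem_range_self _
      refine ⟨i, a, ⟨a, hi.symm, rfl⟩, ?_⟩
      simp only [hi, ← hc, ha]
    · rintro ⟨i, _, ⟨a, ha, rfl⟩, rfl⟩
      simp only [Set.mem_ofPred_eq] at ha
      simp only [← ha, ← hc]
      exact (k a).2

/-- Two piecewise embeddings of `E` into itself with disjoint images. -/
def IsParadoxical (G : Type*) {X : Type*} [Group G] [MulAction G X] (E : Set X) : Prop :=
  ∃ f₀ f₁ : X → X, IsPiecewise G E f₀ ∧ IsPiecewise G E f₁ ∧ Set.MapsTo f₀ E E ∧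
    Set.MapsTo f₁ E E ∧ Set.InjOn f₀ E ∧ Set.InjOn f₁ E ∧ ∀ x ∈ E, ∀ y ∈ E, f₀ x ≠ f₁ y

/-- A set covered by finitely many translates of a paradoxical set `E` embeds piecewise
into `E`. -/
theorem IsParadoxical.piecewiseEmbeds {E : Set X} (hE : IsParadoxical G E) {A : Set X} {T : Set G}
    (hT : T.Finite) (hA : ∀ x ∈ A, ∃ g ∈ T, g⁻¹ • x ∈ E) : PiecewiseEmbeds G A E := by
  obtain ⟨f₀, f₁, hf₀, hf₁, hm₀, hm₁, hi₀, hi₁, hd⟩ := hE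
  obtain ⟨e, he⟩ := Set.countable_iff_exists_injOn.1 hT.countable
  choose! c hcT hc using hA
  -- The maps `f₁^[i] ∘ f₀` have disjoint images: cancelling `f₁^[i]` leaves a value of `f₀` equal
  -- to a value of `f₁`. The translate numbered `i` is sent into the `i`-th image.
  have key : ∀ i k : ℕ, ∀ u ∈ E, ∀ v ∈ E, f₁^[i] (f₀ u) ≠ f₁^[i + k + 1] (f₀ v) := by
    intro i k u hu v hv h
    rw [add_assoc, Function.iterate_add_apply] at h
    have h' := hi₁.iterate hm₁ i (hm₀ hu) (hm₁.iterate (k + 1) (hm₀ hv)) h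
    rw [Function.iterate_succ_apply'] at h'
    exact hd u hu _ (hm₁.iterate k (hm₀ hv)) h'
  refine ⟨fun x => f₁^[e (c x)] (f₀ ((c x)⁻¹ • x)), ?_,
    fun x hx => hm₁.iterate _ (hm₀ (hc x hx)), fun x hx y hy hxy => ?_⟩
  · have hp : ∀ g : G, IsPiecewise G (g • E) (fun x => f₁^[e g] (f₀ (g⁻¹ • x))) := fun g =>
      (((hf₁.iterate hm₁ (e g)).comp hf₀ hm₀).comp (isPiecewise_smul (g • E) g⁻¹)
        fun x hx => Set.mem_smul_set_iff_inv_smul_mem.1 hx)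
    choose S hS hSx using hp
    refine ⟨⋃ g ∈ T, S g, hT.biUnion fun g _ => hS g, fun x hx => ?_⟩
    obtain ⟨k, hk, hkx⟩ := hSx (c x) x (Set.mem_smul_set_iff_inv_smul_mem.2 (hc x hx))
    exact ⟨k, Set.mem_biUnion (hcT x hx) hk, hkx⟩
  · rcases lt_trichotomy (e (c x)) (e (c y)) with h | h | h
    · obtain ⟨k, hk⟩ := Nat.exists_eq_add_of_lt h
      simp only [hk] at hxy
      exact (key _ k _ (hc x hx) _ (hc y hy) hxy).elim
    · have hcc := he (hcT x hx) (hcT y hy) h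
      have h₁ := hc x hx
      have h₂ := hc y hy
      simp only [hcc] at hxy h₁
      exact MulAction.injective _
        (hi₀ h₁ h₂ (hi₁.iterate hm₁ _ (hm₀ h₁) (hm₀ h₂) hxy))
    · obtain ⟨k, hk⟩ := Nat.exists_eq_add_of_lt h
      simp only [hk] at hxy
      exact (key _ k _ (hc y hy) _ (hc x hx) hxy.symm).elim

/-- A free action of a group admits an equivariant map to the group. -/
theorem exists_equivariant_of_free {F : Type*} [Group F] (ψ : F →* G) {E : Set X}
    (hE : ∀ w, ∀ x ∈ E, ψ w • x ∈ E) (hfree : ∀ w, ∀ x ∈ E, ψ w • x = x → w = 1) :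
    ∃ p : X → F, ∀ w, ∀ x ∈ E, p (ψ w • x) = w * p x := by
  let r : Setoid X :=
    { r := fun x y => ∃ w, ψ w • x = y
      iseqv := ⟨fun x => ⟨1, by simp⟩, fun {x y} ⟨w, hw⟩ => ⟨w⁻¹, by simp [← hw]⟩,
        fun {x y z} ⟨w, hw⟩ ⟨v, hv⟩ => ⟨v * w, by simp [← hv, ← hw, mul_smul]⟩⟩ }
  let s : X → X := fun x => (Quotient.mk r x).out
  have hs : ∀ x, ∃ w, ψ w • s x = x := fun x => Quotient.exact (Quotient.out_eq (Quotient.mk r x))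
  choose p hp using hs
  refine ⟨p, fun w x hx => ?_⟩
  have hss : s (ψ w • x) = s x :=
    congrArg Quotient.out (Quotient.sound (s := r) ⟨w⁻¹, by simp⟩)
  have hsE : s x ∈ E := by
    have := hE (p x)⁻¹ x hx
    rwa [map_inv, inv_smul_eq_iff.2 (hp x).symm] at this
  -- Both `w * p x` and `p (ψ w • x)` carry the orbit representative to `ψ w • x`; freeness at the
  -- representative makes them equal.
  have h₁ : ψ ((w * p x)⁻¹ * p (ψ w • x)) • s x = s x := by
    rw [map_mul, mul_smul, ← hss, hp, map_inv, inv_smul_eq_iff, hss, map_mul, mul_smul, hp]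
  exact (inv_mul_eq_one.1 (hfree _ _ hsE h₁)).symm

/-- A set on which a free group of rank two acts freely is paradoxical. -/
theorem isParadoxical_of_free (ψ : FreeGroup Bool →* G) {E : Set X}
    (hE : ∀ w, ∀ x ∈ E, ψ w • x ∈ E) (hfree : ∀ w, ∀ x ∈ E, ψ w • x = x → w = 1) :
    IsParadoxical G E := by
  classical
  obtain ⟨p, hp⟩ := exists_equivariant_of_free ψ hE hfree
  let W : Bool × Bool → Set (FreeGroup Bool) := FreeGroup.startsWith
  -- A word not starting with `b` starts with `b⁻¹` after left multiplication by `b⁻¹`. Hence `f b`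
  -- lands over the words starting with `b` or `b⁻¹`, and these sets are disjoint for the two
  -- generators.
  let f : Bool → X → X := fun b x =>
    if p x ∈ W (b, true) then x else ψ (FreeGroup.mk [(b, false)]) • x
  have hout : ∀ b, ∀ x ∈ E, p x ∉ W (b, true) → p (f b x) ∈ W (b, false) := fun b x hx h => by
    simp only [f, if_neg h]
    rw [hp _ _ hx]
    exact FreeGroup.startsWith_mk_mul _ h
  have hW : ∀ {s t}, s ≠ t → ∀ w ∈ W s, w ∉ W t := fun h w hw hw' =>
    Set.disjoint_left.1 (FreeGroup.startsWith.disjoint_iff_ne.2 h) hw hw'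
  have hin : ∀ b x, p x ∈ W (b, true) → f b x = x := fun b x h => if_pos h
  have hrange : ∀ b, ∀ x ∈ E, ∃ c, p (f b x) ∈ W (b, c) := fun b x hx => by
    by_cases h : p x ∈ W (b, true)
    · exact ⟨true, by rwa [hin b x h]⟩
    · exact ⟨false, hout b x hx h⟩
  have hpw : ∀ b, IsPiecewise G E (f b) := fun b =>
    ⟨{1, ψ (FreeGroup.mk [(b, false)])}, by simp, fun x _ => by
      by_cases h : p x ∈ W (b, true)
      · exact ⟨1, by simp, by simp [f, h]⟩
      · exact ⟨_, by simp, if_neg h⟩⟩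
  have hmaps : ∀ b, Set.MapsTo (f b) E E := fun b x hx => by
    by_cases h : p x ∈ W (b, true)
    · rwa [hin b x h]
    · simp only [f, if_neg h]
      exact hE _ x hx
  have hinj : ∀ b, Set.InjOn (f b) E := fun b x hx y hy hxy => by
    by_cases h : p x ∈ W (b, true) <;> by_cases h' : p y ∈ W (b, true)
    · rwa [hin b x h, hin b y h'] at hxy
    · refine (hW (t := (b, true)) (by simp) _ (hout b y hy h') ?_).elim
      rwa [← hxy, hin b x h]
    · refine (hW (t := (b, true)) (by simp) _ (hout b x hx h) ?_).elim
      rwa [hxy, hin b y h']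
    · simp only [f, if_neg h, if_neg h'] at hxy
      exact MulAction.injective _ hxy
  refine ⟨f false, f true, hpw _, hpw _, hmaps _, hmaps _, hinj _, hinj _, fun x hx y hy hxy => ?_⟩
  obtain ⟨c, hc⟩ := hrange false x hx
  obtain ⟨d, hd⟩ := hrange true y hy
  rw [hxy] at hc
  exact hW (by simp) _ hc hd

end Piecewise

/-! ### A free group of rotations -/

section FreeRotations

open Matrix

/-- Five times the matrix of a rotation by `arccos (3 / 5)` about one of two coordinate axes
(indexed by the first component) or of the inverse rotation. -/
def letter (R : Type*) [CommRing R] : Bool × Bool → Matrix (Fin 3) (Fin 3) R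
  | (false, true) => !![3, 4, 0; -4, 3, 0; 0, 0, 5]
  | (false, false) => !![3, -4, 0; 4, 3, 0; 0, 0, 5]
  | (true, true) => !![5, 0, 0; 0, 3, 4; 0, -4, 3]
  | (true, false) => !![5, 0, 0; 0, 3, -4; 0, 4, 3]

theorem letter_map {R S : Type*} [CommRing R] [CommRing S] (f : R →+* S) (s : Bool × Bool) :
    f.mapMatrix (letter R s) = letter S s := by
  rcases s with ⟨_ | _, _ | _⟩ <;> ext i j <;> fin_cases i <;> fin_cases j <;>
    simp [letter, map_ofNat]

/-- A vector spanning the image of the reduction modulo `5` of a letter. -/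
def letterImage : Bool × Bool → Fin 3 → ZMod 5
  | (false, true) => ![3, 1, 0]
  | (false, false) => ![3, 4, 0]
  | (true, true) => ![0, 3, 1]
  | (true, false) => ![0, 3, 4]

theorem letterImage_ne_zero : ∀ s, letterImage s ≠ 0 := by decide

theorem letter_mulVec_base : ∀ s, ∃ c : ZMod 5, c ≠ 0 ∧
    letter (ZMod 5) s *ᵥ ![0, 1, 0] = c • letterImage s := by decide

/-- Modulo 5 every letter has rank one, and among the four image lines it kills only that of its
inverse. The hypothesis excludes exactly this cancelling pair. -/
theorem letter_mulVec_letterImage : ∀ s t : Bool × Bool, (s.1 = t.1 → s.2 = t.2) →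
    ∃ d : ZMod 5, d ≠ 0 ∧ letter (ZMod 5) s *ᵥ letterImage t = d • letterImage s := by
  decide

theorem prod_letter_mulVec (L : List (Bool × Bool)) : ∀ s, FreeGroup.IsReduced (s :: L) →
    ∃ c : ZMod 5, c ≠ 0 ∧
      (((s :: L).map (letter (ZMod 5))).prod) *ᵥ ![0, 1, 0] = c • letterImage s := by
  have : Fact (Nat.Prime 5) := ⟨by norm_num⟩
  induction L with
  | nil => intro s _; simpa using letter_mulVec_base s
  | cons t L ih =>
    intro s h
    rw [FreeGroup.isReduced_cons_cons] at h
    obtain ⟨c, hc, hcL⟩ := ih t h.2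
    obtain ⟨d, hd, hdL⟩ := letter_mulVec_letterImage s t h.1
    refine ⟨c * d, mul_ne_zero hc hd, ?_⟩
    rw [List.map_cons, List.prod_cons, ← mulVec_mulVec, hcL, mulVec_smul, hdL, smul_smul]

theorem prod_letter_zmod_ne_zero {L : List (Bool × Bool)} (hL : FreeGroup.IsReduced L)
    (hne : L ≠ []) : (L.map (letter (ZMod 5))).prod ≠ 0 := by
  have : Fact (Nat.Prime 5) := ⟨by norm_num⟩
  obtain ⟨s, L, rfl⟩ := List.exists_cons_of_ne_nil hne
  obtain ⟨c, hc, h⟩ := prod_letter_mulVec L s hL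
  intro h0
  rw [h0, zero_mulVec] at h
  have h' : letterImage s = 0 := (smul_eq_zero.1 h.symm).resolve_left hc
  exact absurd h' (letterImage_ne_zero s)

/-- Equality would already hold over the integers, and its right side vanishes modulo 5 because the
word is nonempty, whereas a reduced product does not. -/
theorem prod_letter_real_ne {L : List (Bool × Bool)} (hL : FreeGroup.IsReduced L)
    (hne : L ≠ []) : (L.map (letter ℝ)).prod ≠ (5 : ℝ) ^ L.length • (1 : Matrix (Fin 3) (Fin 3) ℝ) := by
  intro h
  have hmap : ∀ {S : Type} [CommRing S] (f : ℤ →+* S),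
      f.mapMatrix (L.map (letter ℤ)).prod = (L.map (letter S)).prod := fun f => by
    rw [map_list_prod, List.map_map]
    congr 1
    exact List.map_congr_left fun s _ => letter_map f s
  have hZ : (L.map (letter ℤ)).prod = (5 : ℤ) ^ L.length • (1 : Matrix (Fin 3) (Fin 3) ℤ) := by
    have hinj : Function.Injective
        ((Int.castRingHom ℝ).mapMatrix : Matrix (Fin 3) (Fin 3) ℤ →+* Matrix (Fin 3) (Fin 3) ℝ) :=
      Matrix.map_injective Int.cast_injective
    apply hinj
    rw [hmap, h]
    ext i j
    rw [RingHom.mapMatrix_apply, Matrix.map_apply, Matrix.smul_apply, Matrix.smul_apply]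
    by_cases hij : i = j <;> simp [Matrix.one_apply, hij]
  apply prod_letter_zmod_ne_zero hL hne
  rw [← hmap (Int.castRingHom (ZMod 5)), hZ]
  ext i j
  have h5 : (5 : ZMod 5) = 0 := by decide
  have hl : L.length ≠ 0 := by simpa using hne
  rw [RingHom.mapMatrix_apply, Matrix.map_apply, Matrix.smul_apply, smul_eq_mul, map_mul, map_pow]
  simp [h5, hl]

/-- The special orthogonal group acting on `ℝ³`. -/
noncomputable def rotation : specialOrthogonalGroup (Fin 3) ℝ →* G3 where
  toFun A := ⟨⟨fun x => toEuclideanLin A.1 x, fun x => toEuclideanLin A⁻¹.1 x,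
      fun x => by
        have : A⁻¹.1 * A.1 = 1 := congrArg Subtype.val (inv_mul_cancel A)
        simp [toLpLin_apply, mulVec_mulVec, this],
      fun x => by
        have : A.1 * A⁻¹.1 = 1 := congrArg Subtype.val (mul_inv_cancel A)
        simp [toLpLin_apply, mulVec_mulVec, this]⟩, A.1, A.2, 0, fun x => (add_zero _).symm⟩
  map_one' := Subtype.ext (Equiv.ext fun x => by simp)
  map_mul' A B := Subtype.ext (Equiv.ext fun x => by simp [toLpLin_apply, mulVec_mulVec])

/-- Translation by a vector. -/
def translation (t : R3) : G3 :=
  ⟨Equiv.addRight t, 1, one_mem _, t, fun x => by simp⟩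

theorem translation_smul (t x : R3) : translation t • x = x + t := rfl

theorem translation_inv_smul (t x : R3) : (translation t)⁻¹ • x = x - t := by
  rw [inv_smul_eq_iff, translation_smul, sub_add_cancel]

theorem letter_mul_transpose (s : Bool × Bool) :
    letter ℝ s * (letter ℝ s)ᵀ = (25 : ℝ) • (1 : Matrix (Fin 3) (Fin 3) ℝ) := by
  rcases s with ⟨_ | _, _ | _⟩ <;> ext i j <;> fin_cases i <;> fin_cases j <;>
    simp [letter, Matrix.mul_apply, Fin.sum_univ_three] <;> norm_num

theorem det_letter (s : Bool × Bool) : (letter ℝ s).det = 125 := by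
  rcases s with ⟨_ | _, _ | _⟩ <;> simp [letter, Matrix.det_fin_three] <;> norm_num

theorem smul_letter_mem (s : Bool × Bool) :
    (5⁻¹ : ℝ) • letter ℝ s ∈ specialOrthogonalGroup (Fin 3) ℝ := by
  rw [mem_specialOrthogonalGroup_iff, mem_orthogonalGroup_iff, transpose_smul, Matrix.smul_mul,
    Matrix.mul_smul, letter_mul_transpose, smul_smul, smul_smul, det_smul, det_letter]
  norm_num

/-- The rotation by `arccos (3 / 5)` about one of two coordinate axes. -/
noncomputable def generator (s : Bool × Bool) : specialOrthogonalGroup (Fin 3) ℝ := ⟨_, smul_letter_mem s⟩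

theorem generator_inv (b : Bool) : (generator (b, true))⁻¹ = generator (b, false) := by
  rw [inv_eq_iff_mul_eq_one]
  apply Subtype.ext
  have h : letter ℝ (b, false) = (letter ℝ (b, true))ᵀ := by
    cases b <;> ext i j <;> fin_cases i <;> fin_cases j <;> simp [letter]
  simp only [generator, Submonoid.coe_mul, h, Matrix.smul_mul, Matrix.mul_smul,
    letter_mul_transpose, smul_smul, Submonoid.coe_one]
  norm_num

/-- The representation of the free group by rotations. -/
noncomputable def freeRotation : FreeGroup Bool →* specialOrthogonalGroup (Fin 3) ℝ :=
  FreeGroup.lift fun b => generator (b, true)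

theorem coe_freeRotation_mk (L : List (Bool × Bool)) :
    (freeRotation (FreeGroup.mk L)).1 = (5⁻¹ : ℝ) ^ L.length • (L.map (letter ℝ)).prod := by
  rw [freeRotation, FreeGroup.lift_mk]
  induction L with
  | nil => simp
  | cons s L ih =>
    have hs : (cond s.2 (generator (s.1, true)) (generator (s.1, true))⁻¹) = generator s := by
      rcases s with ⟨b, _ | _⟩
      · exact generator_inv b
      · rfl
    rw [List.map_cons, List.prod_cons, hs, Submonoid.coe_mul, ih, List.map_cons, List.prod_cons,
      List.length_cons, pow_succ']
    simp only [generator, Matrix.smul_mul, Matrix.mul_smul, smul_smul]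
    rw [mul_comm]

theorem freeRotation_injective : Function.Injective freeRotation := by
  rw [injective_iff_map_eq_one]
  intro w hw
  by_contra hne
  have hL : w.toWord ≠ [] := by rwa [Ne, FreeGroup.toWord_eq_nil_iff]
  apply prod_letter_real_ne FreeGroup.isReduced_toWord hL
  have h := coe_freeRotation_mk w.toWord
  rw [FreeGroup.mk_toWord, hw] at h
  rw [← Submonoid.coe_one, h, smul_smul, ← mul_pow]
  norm_num

end FreeRotations

/-! ### Axes of rotations, and absorbing bounded sets into a ball -/

section Geometry

open Matrix

/-- For any 3×3 matrix the cofactor matrix carries `u ⨯₃ v` to `(A *ᵥ u) ⨯₃ (A *ᵥ v)`, and a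
rotation is its own cofactor matrix. -/
theorem mulVec_cross {A : Matrix (Fin 3) (Fin 3) ℝ} (hA : A ∈ specialOrthogonalGroup (Fin 3) ℝ)
    (u v : Fin 3 → ℝ) : A *ᵥ (u ⨯₃ v) = (A *ᵥ u) ⨯₃ (A *ᵥ v) := by
  obtain ⟨hO, hdet⟩ := mem_specialOrthogonalGroup_iff.1 hA
  have hs : Aᵀ * A = 1 := (mem_orthogonalGroup_iff' _ _).1 hO
  have hadj : A.adjugate = Aᵀ := by
    have h := congrArg (Aᵀ * ·) (mul_adjugate A)
    simpa [← Matrix.mul_assoc, hs, hdet] using h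
  have hA' : A = A.adjugateᵀ := by rw [hadj, transpose_transpose]
  have key : A.adjugateᵀ *ᵥ (u ⨯₃ v) = (A *ᵥ u) ⨯₃ (A *ᵥ v) := by
    ext i
    fin_cases i <;>
      simp [adjugate_fin_three, cross_apply, mulVec, dotProduct, Fin.sum_univ_three] <;> ring
  rwa [← hA'] at key

/-- The subspace of vectors fixed by a matrix. -/
noncomputable def fixedSpace (A : Matrix (Fin 3) (Fin 3) ℝ) : Submodule ℝ R3 :=
  LinearMap.eqLocus (toEuclideanLin A) LinearMap.id

theorem mem_fixedSpace {A : Matrix (Fin 3) (Fin 3) ℝ} {x : R3} :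
    x ∈ fixedSpace A ↔ toEuclideanLin A x = x := Iff.rfl

/-- If two independent vectors are fixed, so is their cross product, and then `A` fixes a basis. -/
theorem finrank_fixedSpace_le_one {A : Matrix (Fin 3) (Fin 3) ℝ}
    (hA : A ∈ specialOrthogonalGroup (Fin 3) ℝ) (hne : A ≠ 1) :
    Module.finrank ℝ (fixedSpace A) ≤ 1 := by
  rcases eq_or_ne (fixedSpace A) ⊥ with hbot | hbot
  · rw [hbot, finrank_bot]; exact zero_le_one
  obtain ⟨u, hu, hu0⟩ := (Submodule.ne_bot_iff _).1 hbot
  refine finrank_le_one ⟨u, hu⟩ ?_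
  rintro ⟨v, hv⟩
  by_contra! hc
  apply hne
  have hfix : ∀ {x : R3}, x ∈ fixedSpace A → A *ᵥ x.ofLp = x.ofLp := fun h =>
    congrArg WithLp.ofLp (mem_fixedSpace.1 h)
  set n := u.ofLp ⨯₃ v.ofLp with hn
  have hnfix : A *ᵥ n = n := by rw [hn, mulVec_cross hA, hfix hu, hfix hv]
  have hn0 : n ⬝ᵥ n ≠ 0 := by
    rw [Ne, dotProduct_self_eq_zero, ← Ne, hn, crossProduct_ne_zero_iff_linearIndependent,
      LinearIndependent.pair_iff' (by simpa using hu0)]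
    intro a ha
    exact hc a (Subtype.ext (WithLp.ofLp_injective 2 (by simpa using ha)))
  -- Cramer's rule in the basis `u, v, n`, whose determinant is `n ⬝ᵥ n`.
  have hdec : ∀ x : Fin 3 → ℝ, (n ⬝ᵥ n) • x = (x ⬝ᵥ (v.ofLp ⨯₃ n)) • u.ofLp +
      (x ⬝ᵥ (n ⨯₃ u.ofLp)) • v.ofLp + (x ⬝ᵥ n) • n := by
    intro x
    rw [hn]
    ext i
    fin_cases i <;> simp [cross_apply, dotProduct, Fin.sum_univ_three] <;> ring
  have hone : ∀ x : Fin 3 → ℝ, A *ᵥ x = x := by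
    intro x
    apply smul_right_injective _ hn0
    simp only
    rw [← mulVec_smul]
    conv_lhs => rw [hdec]
    rw [hdec]
    simp only [mulVec_add, mulVec_smul, hfix hu, hfix hv, hnfix]
  exact Matrix.ext_of_mulVec_single fun i => by rw [hone, one_mulVec]

/-- The representation of the free group by isometries of `ℝ³`. -/
noncomputable def freeAction : FreeGroup Bool →* G3 := rotation.comp freeRotation

theorem freeAction_smul (w : FreeGroup Bool) (x : R3) :
    freeAction w • x = toEuclideanLin (freeRotation w).1 x := rfl

theorem norm_freeAction_smul (w : FreeGroup Bool) (x : R3) : ‖freeAction w • x‖ = ‖x‖ := by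
  have hs : (freeRotation w).1ᵀ * (freeRotation w).1 = 1 :=
    (mem_orthogonalGroup_iff' _ _).1 (mem_specialOrthogonalGroup_iff.1 (freeRotation w).2).1
  rw [← sq_eq_sq₀ (norm_nonneg _) (norm_nonneg _), ← real_inner_self_eq_norm_sq,
    ← real_inner_self_eq_norm_sq, freeAction_smul, EuclideanSpace.inner_eq_star_dotProduct,
    EuclideanSpace.inner_eq_star_dotProduct, star_trivial, star_trivial, toLpLin_apply,
    dotProduct_mulVec, ← mulVec_transpose, mulVec_mulVec, hs, one_mulVec]

/-- There are arbitrarily short vectors that are not a difference of two points, each fixed by a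
nontrivial element of the free group. -/
theorem exists_short_translation {δ : ℝ} (hδ : 0 < δ) : ∃ t : R3, ‖t‖ < δ ∧
    ∀ x : R3, ∀ w ≠ 1, ∀ w' ≠ 1, freeAction w • x = x →
      freeAction w' • (x - t) ≠ x - t := by
  let ι := {w : FreeGroup Bool // w ≠ 1}
  let V : ι → Submodule ℝ R3 := fun w => fixedSpace (freeRotation w.1).1
  have hV : ∀ w, Module.finrank ℝ (V w) ≤ 1 := fun w =>
    finrank_fixedSpace_le_one (freeRotation w.1).2 fun h =>
      w.2 (freeRotation_injective (by rw [map_one]; exact Subtype.ext h))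
  have hnull : MeasureTheory.volume (⋃ p : ι × ι, ((V p.1 ⊔ V p.2 : Submodule ℝ R3) : Set R3)) =
      0 := by
    have : Countable ι := Subtype.countable
    -- A sum of two subspaces of dimension at most one is proper in dimension three, hence null, and
    -- there are only countably many such sums.
    refine MeasureTheory.measure_iUnion_null fun p =>
      MeasureTheory.Measure.addHaar_submodule _ _ fun htop => ?_
    have h₁ := Submodule.finrank_add_le_finrank_add_finrank (V p.1) (V p.2)
    rw [htop, finrank_top, finrank_euclideanSpace_fin] at h₁
    have h₂ := hV p.1
    have h₃ := hV p.2
    omega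
  obtain ⟨t, ht, htV⟩ : ∃ t ∈ Metric.ball (0 : R3) δ,
      t ∉ ⋃ p : ι × ι, ((V p.1 ⊔ V p.2 : Submodule ℝ R3) : Set R3) := by
    by_contra! h
    exact (Metric.measure_ball_pos MeasureTheory.volume (0 : R3) hδ).ne'
      (MeasureTheory.measure_mono_null h hnull)
  refine ⟨t, by simpa using ht, fun x w hw w' hw' hx hx' => htV ?_⟩
  refine Set.mem_iUnion.2 ⟨(⟨w, hw⟩, ⟨w', hw'⟩), ?_⟩
  -- Here `t = x - (x - t)` would lie in the sum of the two fixed spaces.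
  have := sub_mem (Submodule.mem_sup_left (T := V ⟨w', hw'⟩) (show x ∈ V ⟨w, hw⟩ from hx))
    (Submodule.mem_sup_right (S := V ⟨w, hw⟩) (show x - t ∈ V ⟨w', hw'⟩ from hx'))
  simpa using this

/-- The points of a ball on which the free group acts freely. -/
def freeBall (r : ℝ) : Set R3 :=
  {x | ‖x‖ < r ∧ ∀ w, freeAction w • x = x → w = 1}

theorem isParadoxical_freeBall (r : ℝ) : IsParadoxical G3 (freeBall r) := by
  refine isParadoxical_of_free freeAction (fun w x hx => ⟨?_, fun v hv => ?_⟩)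
    fun w x hx => hx.2 w
  · rw [norm_freeAction_smul]; exact hx.1
  -- Stabilizers along an orbit are conjugate.
  · have h : w⁻¹ * v * w = 1 := hx.2 _ (by
      rw [map_mul, map_mul, mul_smul, mul_smul, hv, map_inv, inv_smul_smul])
    simpa [mul_assoc, inv_mul_eq_one] using h

/-- Balls of radius `r / 2` about finitely many centres `c` cover `A`. If `x - c` has a nontrivial
stabilizer, then `x - c - t` has none, and `‖t‖ < r / 2` keeps it in the ball of radius `r`. -/
theorem piecewiseEmbeds_freeBall {A : Set R3} (hA : Bornology.IsBounded A) {r : ℝ} (hr : 0 < r) :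
    PiecewiseEmbeds G3 A (freeBall r) := by
  obtain ⟨t, ht, htfix⟩ := exists_short_translation (half_pos hr)
  obtain ⟨C, hC, hAC⟩ := Metric.totallyBounded_iff.1
    (TotallyBounded.subset subset_closure hA.isCompact_closure.totallyBounded) (r / 2) (half_pos hr)
  refine (isParadoxical_freeBall r).piecewiseEmbeds
    (T := translation '' C ∪ (fun c => translation (c + t)) '' C)
    ((hC.image _).union (hC.image _)) fun x hx => ?_
  obtain ⟨c, hc, hxc⟩ := Set.mem_iUnion₂.1 (hAC hx)
  rw [Metric.mem_ball, dist_eq_norm] at hxc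
  by_cases hfix : ∀ w, freeAction w • (x - c) = x - c → w = 1
  · exact ⟨_, Or.inl ⟨c, hc, rfl⟩, by
      rw [translation_inv_smul]; exact ⟨by linarith, hfix⟩⟩
  · push Not at hfix
    obtain ⟨w, hw, hw1⟩ := hfix
    refine ⟨_, Or.inr ⟨c, hc, rfl⟩, ?_⟩
    simp only
    rw [translation_inv_smul, ← sub_sub]
    refine ⟨by linarith [norm_sub_le (x - c) t], fun w' hw' => ?_⟩
    by_contra hw'1
    exact htfix _ w hw1 w' hw'1 hw hw'

theorem piecewiseEmbeds_of_isBounded {A B : Set R3} (hA : Bornology.IsBounded A)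
    (hB : (interior B).Nonempty) : PiecewiseEmbeds G3 A B := by
  obtain ⟨c, hc⟩ := hB
  obtain ⟨r, hr, hrB⟩ := Metric.mem_nhds_iff.1 (mem_interior_iff_mem_nhds.1 hc)
  refine (piecewiseEmbeds_freeBall hA hr).trans
    (PiecewiseEmbeds.of_smul_subset (translation c) ?_)
  rintro _ ⟨x, hx, rfl⟩
  apply hrB
  simpa [translation_smul, dist_eq_norm] using hx.1

end Geometry

end BanachTarski

theorem mainTheorem1 (A B : Set BanachTarski.R3)
    (hA : Bornology.IsBounded A) (hB : Bornology.IsBounded B)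
    (hA' : (interior A).Nonempty) (hB' : (interior B).Nonempty) :
    BanachTarski.Equidecomposable BanachTarski.G3 A B :=
  (BanachTarski.piecewiseEmbeds_of_isBounded hA hB').equidecomposable
    (BanachTarski.piecewiseEmbeds_of_isBounded hB hA')
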